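/- For an integer $s$ and $m\ge 1$ write $\sigma_s(m)=\sum_{d\mid m}d^s$, let $B_n$ be the $n$th Bernoulli number and $\zeta$ the Riemann zeta function. Let $h$ and $k$ be positive integers with $k\equiv 2 \bmod 4$ and $h>k/2$. Then $$ \zeta(2h-1)=\frac{(h-k/2-1)!}{(2h-2)!}\Bigg\{\frac{(4\pi)^{2h-1}(h+k/2-1)!\,|B_{2h}|}{2(2h)!}-\sum_{m=1}^\infty \sigma_{1-2h}(m)e^{-2\pi m} \sum_{\ell=1-k/2}^{h}\frac{k!\,(h+\ell-2)!}{(\ell+k/2-1)!\,(h-\ell)!}\left[\binom{k/2+h-1}{k}+\binom{k/2+\ell-1}{k}\right](4\pi m)^{h-\ell}\Bigg\}, $$ where the series over $m$ converges absolutely. In particular, for $k=2$ this is the Terras–Grosswald formula: for every integer $h\ge 2$, $$ \zeta(2h-1)=\frac{(h-2)!}{(2h-2)!}\Bigg\{\frac{(4\pi)^{2h-1}h!\,|B_{2h}|}{2(2h)!}-\sum_{m=1}^\infty\sigma_{1-2h}(m)e^{-2\pi m}\sum_{\ell=0}^{h}\frac{(h+\ell-2)!\,\big[h(h-1)+\ell(\ell-1)\big]}{\ell!\,(h-\ell)!}(4\pi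 m)^{h-\ell}\Bigg\}, $$ again with an absolutely convergent series over $m$. -/

import Mathlib

open scoped Nat

/-- The divisor power function `σ_s(m) = ∑_{d ∣ m} d ^ s` for an integer exponent `s`
(possibly negative) and `m ≥ 1`. -/
noncomputable def divisorPower (s : ℤ) (m : ℕ) : ℝ :=
  ∑ d ∈ m.divisors, (d : ℝ) ^ s

/-- The `m`-th term of the series for `ζ(2h-1)` attached to `h` and an even `k`:
`σ_{1-2h}(m) e^{-2πm} ∑_{ℓ=1-k/2}^{h} k! (h+ℓ-2)! / ((ℓ+k/2-1)! (h-ℓ)!)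
  * [binom(k/2+h-1, k) + binom(k/2+ℓ-1, k)] * (4πm)^{h-ℓ}`.
For `k/2 < h` every factorial and binomial argument is nonnegative, so `Int.toNat` is harmless. -/
noncomputable def zetaSeriesTerm (h k m : ℕ) : ℝ :=
  divisorPower (1 - 2 * (h : ℤ)) m * Real.exp (-2 * Real.pi * (m : ℝ)) *
    ∑ l ∈ Finset.Icc (1 - ((k / 2 : ℕ) : ℤ)) (h : ℤ),
      ((k ! : ℝ) * ((((h : ℤ) + l - 2).toNat)! : ℝ)) /
          ((((l + ((k / 2 : ℕ) : ℤ) - 1).toNat)! : ℝ) * ((((h : ℤ) - l).toNat)! : ℝ)) *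
        (((k / 2 + h - 1).choose k : ℝ) +
          (((((k / 2 : ℕ) : ℤ) + l - 1).toNat).choose k : ℝ)) *
        (4 * Real.pi * (m : ℝ)) ^ ((h : ℤ) - l)

/-- The `m`-th term of the Terras-Grosswald series for `ζ(2h-1)`, `h ≥ 2`:
`σ_{1-2h}(m) e^{-2πm} ∑_{ℓ=0}^{h} (h+ℓ-2)! [h(h-1)+ℓ(ℓ-1)] / (ℓ! (h-ℓ)!) * (4πm)^{h-ℓ}`. -/
noncomputable def terrasGrosswaldTerm (h m : ℕ) : ℝ :=
  divisorPower (1 - 2 * (h : ℤ)) m * Real.exp (-2 * Real.pi * (m : ℝ)) *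
    ∑ l ∈ Finset.range (h + 1),
      ((h + l - 2)! : ℝ) * ((h : ℝ) * ((h : ℝ) - 1) + (l : ℝ) * ((l : ℝ) - 1)) /
          ((l ! : ℝ) * ((h - l)! : ℝ)) *
        (4 * Real.pi * (m : ℝ)) ^ (h - l)

/-! Put p + 1 = h + k/2 and q + 1 = h - k/2. The sum of 1/((mi+n)^(p+1) (mi-n)^(q+1)) over nonzero
Gaussian integers mi+n converges absolutely. Rotating the lattice by -i changes its sign because k/2
is odd, so it vanishes (`tsum_lattice_mixed_pow_eq_zero`).

The row m = 0 contributes a multiple of ζ(2h), that is, of B_{2h}. In every other row, partial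
fractions (`one_div_pow_mul_pow_eq_sum`) reduce the sum over n to Lipschitz sums
(`hasSum_mixed_pow`), giving exponentials e^(-2πmr) with polynomial coefficients plus a constant.
Summed over m, the constants produce ζ(2h-1) and the exponentials a Lambert series
(`riemannZeta_odd_eq_lambertSeries`). Grouping by N = mr gives the divisor sums. -/

/-! ### Partial fractions. -/

/-- The Chaundy-Bullard identity. -/
theorem chaundy_bullard {R : Type*} [CommRing R] {u v : R} (huv : u + v = 1) (p q : ℕ) :
    v ^ (q + 1) * ∑ i ∈ Finset.range (p + 1), ((q + i).choose i : R) * u ^ i +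
      u ^ (p + 1) * ∑ i ∈ Finset.range (q + 1), ((p + i).choose i : R) * v ^ i = 1 := by
  have geom : ∀ {x y : R}, x + y = 1 → ∀ n : ℕ,
      x * ∑ i ∈ Finset.range n, y ^ i = 1 - y ^ n := by
    intro x y h n
    rw [← mul_neg_geom_sum y n, ← h]
    ring
  -- Pascal's rule. It makes the case (p+1, q+1) equal to u times (p, q+1) plus v times (p+1, q).
  have step : ∀ (p q : ℕ) (u : R),
      ∑ i ∈ Finset.range (p + 2), ((q + 1 + i).choose i : R) * u ^ i =
        u * ∑ i ∈ Finset.range (p + 1), ((q + 1 + i).choose i : R) * u ^ i +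
          ∑ i ∈ Finset.range (p + 2), ((q + i).choose i : R) * u ^ i := by
    intro p q u
    rw [Finset.sum_range_succ' _ (p + 1), Finset.sum_range_succ' _ (p + 1), Finset.mul_sum,
      ← add_assoc, ← Finset.sum_add_distrib]
    simp only [Nat.choose_zero_right]
    congr 1
    refine Finset.sum_congr rfl fun i _ => ?_
    rw [show q + 1 + (i + 1) = (q + 1 + i) + 1 by ring, Nat.choose_succ_succ,
      show q + (i + 1) = q + 1 + i by ring]
    push_cast
    ring
  induction p generalizing q with
  | zero =>
    have := geom huv (q + 1)
    simp only [zero_add, Finset.sum_range_one, add_zero, Nat.choose_zero_right, pow_zero,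
      Nat.choose_self, Nat.cast_one, one_mul, mul_one, pow_one, this]
    ring
  | succ p ihp =>
    induction q with
    | zero =>
      have := geom (by rw [add_comm]; exact huv : v + u = 1) (p + 2)
      simp only [zero_add, Finset.sum_range_one, add_zero, Nat.choose_zero_right, pow_zero,
        Nat.choose_self, Nat.cast_one, one_mul, mul_one, pow_one, this]
      ring
    | succ q ihq =>
      have h := ihp (q + 1)
      rw [step p q u, step q p v]
      linear_combination u * h + v * ihq + huv

theorem one_div_pow_mul_pow_eq_sum {K : Type*} [Field K] {u v : K} (huv : u + v = 1)
    (hu : u ≠ 0) (hv : v ≠ 0) (p q : ℕ) :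
    1 / (u ^ (p + 1) * v ^ (q + 1)) =
      ∑ i ∈ Finset.range (p + 1), ((q + i).choose i : K) * (1 / u ^ (p - i + 1)) +
      ∑ i ∈ Finset.range (q + 1), ((p + i).choose i : K) * (1 / v ^ (q - i + 1)) := by
  have key : ∀ {w : K}, w ≠ 0 → ∀ p q : ℕ,
      ∑ i ∈ Finset.range (p + 1), ((q + i).choose i : K) * (1 / w ^ (p - i + 1)) =
        (∑ i ∈ Finset.range (p + 1), ((q + i).choose i : K) * w ^ i) / w ^ (p + 1) := by
    intro w hw p q
    rw [Finset.sum_div]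
    refine Finset.sum_congr rfl fun i hi => ?_
    have hi' : i ≤ p := Nat.lt_succ_iff.mp (Finset.mem_range.mp hi)
    rw [mul_div_assoc]
    congr 1
    rw [div_eq_div_iff (by positivity) (by positivity), one_mul, ← pow_add]
    congr 1
    omega
  rw [key hu, key hv, div_add_div _ _ (pow_ne_zero _ hu) (pow_ne_zero _ hv)]
  congr 1
  rw [← chaundy_bullard huv p q]
  ring

/-! ### Row sums by the Lipschitz formula. -/

/-- The Lipschitz series `∑ (4πmr)^j / j! * exp (-2πmr)`, with its constant term for `j = 0`. -/
noncomputable def lipschitzSum (j : ℕ) (m : ℕ+) : ℝ :=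
  ∑' r : ℕ+, (4 * Real.pi * m * r) ^ j / (j ! : ℝ) * Real.exp (-2 * Real.pi * m * r) +
    if j = 0 then 1 / 2 else 0

open SummationFilter Complex in
/-- The Lipschitz formula on the imaginary axis, with the conditionally convergent case `j = 0`. -/
theorem hasSum_lipschitz (j : ℕ) (m : ℕ+) :
    HasSum (fun n : ℤ => (2 * (m * I) : ℂ) ^ (j + 1) / (m * I + n) ^ (j + 1))
      ((4 * Real.pi * m * lipschitzSum j m : ℝ) : ℂ) (symmetricIcc ℤ) := by
  have hm : (m : ℂ) ≠ 0 := by exact_mod_cast m.ne_zero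
  let z : UpperHalfPlane := ⟨m * I, by simp⟩
  have hz : (z : ℂ) = m * I := rfl
  have hexp : ∀ r : ℕ, cexp (2 * Real.pi * I * (m * I)) ^ r =
      ((Real.exp (-2 * Real.pi * m * r) : ℝ) : ℂ) := by
    intro r
    rw [← Complex.exp_nat_mul]
    push_cast
    congr 1
    linear_combination (2 * Real.pi * m * r : ℂ) * I_sq
  unfold lipschitzSum
  rcases Nat.eq_zero_or_pos j with rfl | hj
  · have hzi : (z : ℂ) ∈ integerComplement := UpperHalfPlane.coe_mem_integerComplement z
    have h1 := tendsto_logDeriv_euler_cot_sub hzi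
    have h2 := pi_mul_cot_pi_q_exp z
    rw [h2] at h1
    have hsum : Summable fun n : ℕ => cexp (2 * Real.pi * I * z) ^ n :=
      summable_geometric_of_norm_lt_one (UpperHalfPlane.norm_exp_two_pi_I_lt_one z)
    rw [← tsum_zero_pnat_eq_tsum_nat hsum, hz] at h1
    simp only [hexp] at h1
    rw [hasSum_symmetricIcc_iff]
    -- Pairing n with -n turns the symmetric partial sums into those of the cotangent expansion.
    have hS : ∀ N : ℕ, ∑ n ∈ Finset.Icc (-(N : ℤ)) N,
        (2 * (m * I) : ℂ) ^ (0 + 1) / (m * I + n) ^ (0 + 1) =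
        2 * (m * I) * (∑ j ∈ Finset.range N, cotTerm (m * I) j + 1 / (m * I)) := by
      intro N
      induction N with
      | zero => simp [div_eq_mul_inv]
      | succ N ih =>
        push_cast
        rw [Finset.sum_Icc_succ_eq_add_endpoints, ih, Finset.sum_range_succ]
        push_cast [cotTerm]
        simp only [pow_one, ← sub_eq_add_neg]
        ring
    simp only [hS]
    convert (h1.add_const (1 / (m * I : ℂ))).const_mul (2 * (m * I : ℂ)) using 2
    push_cast
    simp only [pow_zero, Nat.factorial_zero, Nat.cast_one, div_one, one_mul, mul_zero, exp_zero]
    linear_combination (4 * Real.pi * m * (∑' r : ℕ+, cexp (-2 * Real.pi * m * r) + 1 / 2) : ℂ)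
      * I_sq
  · have hs := EisensteinSeries.linear_right_summable (m * I) 1 (k := (j + 1 : ℕ)) (by omega)
    have h := EisensteinSeries.qExpansion_identity_pnat hj z
    rw [hz] at h
    simp only [hexp] at h
    have hs' : Summable (fun n : ℤ => 1 / ((m * I : ℂ) + n) ^ (j + 1)) := by
      simpa only [Int.cast_one, one_mul, zpow_natCast, one_div] using hs
    have h3 := (hs'.hasSum.mul_left ((2 * (m * I) : ℂ) ^ (j + 1)))
    rw [h] at h3
    have h4 : HasSum _ _ (symmetricIcc ℤ) := h3.mono_left (symmetricIcc ℤ).le_atTop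
    simp only [mul_one_div] at h4
    have hval : ((4 * Real.pi * m * (∑' r : ℕ+, (4 * Real.pi * m * r) ^ j / (j ! : ℝ) *
          Real.exp (-2 * Real.pi * m * r) + if j = 0 then 1 / 2 else 0) : ℝ) : ℂ) =
        (2 * (m * I) : ℂ) ^ (j + 1) * ((-2 * Real.pi * I) ^ (j + 1) / (j ! : ℂ) *
          ∑' r : ℕ+, (r : ℂ) ^ j * ((Real.exp (-2 * Real.pi * m * r) : ℝ) : ℂ)) := by
      push_cast
      rw [if_neg hj.ne', Complex.ofReal_zero, add_zero, ← mul_assoc, ← mul_div_assoc, ← mul_pow,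
        show (2 * (m * I) * (-2 * Real.pi * I) : ℂ) = 4 * Real.pi * m by
          linear_combination (-4 * Real.pi * m : ℂ) * I_sq, ← tsum_mul_left, ← tsum_mul_left]
      refine tsum_congr fun r => ?_
      ring
    rw [hval]
    exact h4

open SummationFilter Complex in
theorem hasSum_lipschitz_neg (j : ℕ) (m : ℕ+) :
    HasSum (fun n : ℤ => (2 * (m * I) : ℂ) ^ (j + 1) / (m * I - n) ^ (j + 1))
      ((4 * Real.pi * m * lipschitzSum j m : ℝ) : ℂ) (symmetricIcc ℤ) := by
  have h := hasSum_lipschitz j m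
  rw [hasSum_symmetricIcc_iff] at h ⊢
  refine h.congr fun N => ?_
  refine Finset.sum_equiv (Equiv.neg ℤ) (fun i => ?_) (fun i _ => ?_)
  · simp only [Finset.mem_Icc, Equiv.neg_apply]
    omega
  · simp [sub_eq_add_neg]

-- Partial fractions apply with u, v = (mi ± n)/(2mi), which add up to 1. The terms i = p and i = q
-- have simple poles, whose sums converge only over symmetric intervals.
open SummationFilter Complex in
theorem hasSum_mixed_pow (p q : ℕ) (m : ℕ+) :
    HasSum (fun n : ℤ => (2 * (m * I) : ℂ) ^ (p + q + 2) /
        ((m * I + n) ^ (p + 1) * (m * I - n) ^ (q + 1)))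
      ((4 * Real.pi * m * (∑ i ∈ Finset.range (p + 1), (q + i).choose i * lipschitzSum (p - i) m +
        ∑ i ∈ Finset.range (q + 1), (p + i).choose i * lipschitzSum (q - i) m) : ℝ) : ℂ)
      (symmetricIcc ℤ) := by
  have hm : (m * I : ℂ) ≠ 0 := mul_ne_zero (by exact_mod_cast m.ne_zero) I_ne_zero
  have him : (m * I : ℂ).im ≠ 0 := by simp
  have h1 := hasSum_sum (s := Finset.range (p + 1)) fun i _ =>
    (hasSum_lipschitz (p - i) m).mul_left (((q + i).choose i : ℂ))
  have h2 := hasSum_sum (s := Finset.range (q + 1)) fun i _ =>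
    (hasSum_lipschitz_neg (q - i) m).mul_left (((p + i).choose i : ℂ))
  have hfun : ∀ n : ℤ, (2 * (m * I) : ℂ) ^ (p + q + 2) /
        ((m * I + n) ^ (p + 1) * (m * I - n) ^ (q + 1)) =
      ∑ i ∈ Finset.range (p + 1), ((q + i).choose i : ℂ) *
        ((2 * (m * I)) ^ (p - i + 1) / (m * I + n) ^ (p - i + 1)) +
      ∑ i ∈ Finset.range (q + 1), ((p + i).choose i : ℂ) *
        ((2 * (m * I)) ^ (q - i + 1) / (m * I - n) ^ (q - i + 1)) := by
    intro n
    have hp : (m * I + n : ℂ) ≠ 0 := fun h => him (by simpa using congrArg im h)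
    have hn : (m * I - n : ℂ) ≠ 0 := fun h => him (by simpa using congrArg im h)
    have h2m : (2 * (m * I) : ℂ) ≠ 0 := mul_ne_zero two_ne_zero hm
    have := one_div_pow_mul_pow_eq_sum (u := (m * I + n : ℂ) / (2 * (m * I)))
      (v := (m * I - n : ℂ) / (2 * (m * I))) (by rw [← add_div, div_eq_one_iff_eq h2m]; ring)
      (div_ne_zero hp h2m) (div_ne_zero hn h2m) p q
    simp only [div_pow, one_div_div] at this
    rw [← this, div_mul_div_comm, one_div_div, ← pow_add]
    congr 2
    ring
  have hval : ((4 * Real.pi * m *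
        (∑ i ∈ Finset.range (p + 1), (q + i).choose i * lipschitzSum (p - i) m +
        ∑ i ∈ Finset.range (q + 1), (p + i).choose i * lipschitzSum (q - i) m) : ℝ) : ℂ) =
      ∑ i ∈ Finset.range (p + 1), ((q + i).choose i : ℂ) *
        ((4 * Real.pi * m * lipschitzSum (p - i) m : ℝ) : ℂ) +
      ∑ i ∈ Finset.range (q + 1), ((p + i).choose i : ℂ) *
        ((4 * Real.pi * m * lipschitzSum (q - i) m : ℝ) : ℂ) := by
    push_cast
    rw [mul_add, Finset.mul_sum, Finset.mul_sum]
    congr 1 <;> exact Finset.sum_congr rfl fun i _ => by ring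
  rw [hval]
  simp only [hfun]
  exact h1.add h2

/-! ### The lattice sum and its vanishing. -/

-- Since |mi-n| = |mi+n|, the bound for Eisenstein series of weight p + q + 2 > 2 at the point i
-- applies.
open Complex in
theorem summable_lattice_mixed_pow {p q : ℕ} (hpq : 1 ≤ p + q) :
    Summable fun x : ℤ × ℤ =>
      1 / ((x.1 * I + x.2 : ℂ) ^ (p + 1) * (x.1 * I - x.2) ^ (q + 1)) := by
  have hs := (EisensteinSeries.summable_one_div_norm_rpow
    (k := ((p + q + 2 : ℕ) : ℝ)) (by push_cast; norm_cast; omega)).mul_left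
      (EisensteinSeries.r UpperHalfPlane.I ^ (-((p + q + 2 : ℕ) : ℝ)))
  rw [← (finTwoArrowEquiv ℤ).symm.summable_iff] at hs
  refine Summable.of_norm_bounded hs fun x => ?_
  have h := EisensteinSeries.summand_bound UpperHalfPlane.I
    (k := ((p + q + 2 : ℕ) : ℝ)) (by positivity) ((finTwoArrowEquiv ℤ).symm x)
  refine le_trans (le_of_eq ?_) h
  have hconj : ‖(x.1 * I - x.2 : ℂ)‖ = ‖(x.1 * I + x.2 : ℂ)‖ := by
    rw [← norm_neg, ← norm_conj]
    congr 1
    simp [add_comm]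
  have h0 : ((finTwoArrowEquiv ℤ).symm x) 0 = x.1 := rfl
  have h1 : ((finTwoArrowEquiv ℤ).symm x) 1 = x.2 := rfl
  rw [h0, h1, UpperHalfPlane.coe_I, norm_div, norm_mul, norm_pow, norm_pow, hconj, norm_one,
    ← pow_add, Real.rpow_neg (norm_nonneg _), Real.rpow_natCast, one_div]
  congr 2
  ring

-- The rotation mi+n ↦ -i(mi+n) permutes the lattice and multiplies each term by -1, by the parity
-- of q + 1 + h.
open Complex in
theorem tsum_lattice_mixed_pow_eq_zero {p q h : ℕ} (hpq : p + q + 2 = 2 * h)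
    (hodd : Odd (q + 1 + h)) :
    ∑' x : ℤ × ℤ, 1 / ((x.1 * I + x.2 : ℂ) ^ (p + 1) * (x.1 * I - x.2) ^ (q + 1)) = 0 := by
  let e : ℤ × ℤ ≃ ℤ × ℤ := (Equiv.prodComm ℤ ℤ).trans ((Equiv.neg ℤ).prodCongr (Equiv.refl ℤ))
  have hI : (-I : ℂ) ^ (p + 1) * I ^ (q + 1) = -1 := by
    have hodd' : Odd (p + 1 + h) := by
      obtain ⟨c, hc⟩ := hodd
      exact ⟨2 * h - 1 - c, by omega⟩
    rw [neg_pow, mul_assoc, ← pow_add, show p + 1 + (q + 1) = 2 * h by omega, pow_mul, I_sq,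
      ← pow_add, hodd'.neg_one_pow]
  have key := e.tsum_eq fun x : ℤ × ℤ =>
    1 / ((x.1 * I + x.2 : ℂ) ^ (p + 1) * (x.1 * I - x.2) ^ (q + 1))
  have hterm : ∀ x : ℤ × ℤ, 1 / (((e x).1 * I + (e x).2 : ℂ) ^ (p + 1) *
      ((e x).1 * I - (e x).2) ^ (q + 1)) =
      -(1 / ((x.1 * I + x.2 : ℂ) ^ (p + 1) * (x.1 * I - x.2) ^ (q + 1))) := by
    intro x
    have e1 : (e x).1 = -x.2 := rfl
    have e2 : (e x).2 = x.1 := rfl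
    have h1 : (-x.2 * I + x.1 : ℂ) = -I * (x.1 * I + x.2) := by
      linear_combination (x.1 : ℂ) * I_sq
    have h2 : (-x.2 * I - x.1 : ℂ) = I * (x.1 * I - x.2) := by
      linear_combination (-x.1 : ℂ) * I_sq
    rw [e1, e2, Int.cast_neg, h1, h2, mul_pow, mul_pow, mul_mul_mul_comm, hI, neg_one_mul, div_neg]
  simp only [hterm, tsum_neg] at key
  exact self_eq_neg.mp key.symm

open Complex in
theorem hasSum_lipschitzSum_riemannZeta {p q h : ℕ} (hpq : p + q + 2 = 2 * h) (hh : 2 ≤ h)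
    (hodd : Odd (q + 1 + h)) :
    HasSum (fun m : ℕ+ => ((4 * Real.pi * m *
      (∑ i ∈ Finset.range (p + 1), (q + i).choose i * lipschitzSum (p - i) m +
        ∑ i ∈ Finset.range (q + 1), (p + i).choose i * lipschitzSum (q - i) m) /
        (2 * m : ℝ) ^ (2 * h) : ℝ) : ℂ)) (riemannZeta (2 * h)) := by
  have hs := summable_lattice_mixed_pow (p := p) (q := q) (by omega)
  have h0 := tsum_lattice_mixed_pow_eq_zero hpq hodd
  have heven : Even (p + q + 2) := ⟨h, by omega⟩
  rw [hs.tsum_prod, tsum_int_eq_zero_add_two_mul_tsum_pnat ?_ hs.prod] at h0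
  swap
  · intro m
    beta_reduce
    rw [← (Equiv.neg ℤ).tsum_eq]
    refine tsum_congr fun n => ?_
    have h1 : (((-m : ℤ) : ℂ) * I + ((-n : ℤ) : ℂ)) = -(m * I + n) := by push_cast; ring
    have h2 : (((-m : ℤ) : ℂ) * I - ((-n : ℤ) : ℂ)) = -(m * I - n) := by push_cast; ring
    simp only [Equiv.neg_apply]
    rw [h1, h2, neg_pow, neg_pow (_ - _), mul_mul_mul_comm, ← pow_add,
      show p + 1 + (q + 1) = p + q + 2 by ring, heven.neg_one_pow, one_mul]
  have hin : ∀ m : ℕ+, ∑' n : ℤ, 1 / ((((m : ℤ) : ℂ) * I + n) ^ (p + 1) *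
      (((m : ℤ) : ℂ) * I - n) ^ (q + 1)) = (-1) ^ h * ((4 * Real.pi * m *
      (∑ i ∈ Finset.range (p + 1), (q + i).choose i * lipschitzSum (p - i) m +
        ∑ i ∈ Finset.range (q + 1), (p + i).choose i * lipschitzSum (q - i) m) /
        (2 * m : ℝ) ^ (2 * h) : ℝ) : ℂ) := by
    intro m
    have hm : (m : ℂ) ≠ 0 := by exact_mod_cast m.ne_zero
    -- This (-1)^h is opposite to the sign (-1)^(q+1) of the row m = 0, so ζ(2h) equals the sum over
    -- m > 0 without a sign.
    have hc : (2 * (m * I) : ℂ) ^ (p + q + 2) = (-1) ^ h * (2 * m : ℂ) ^ (2 * h) := by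
      rw [hpq, ← mul_assoc, mul_pow _ I, pow_mul I, I_sq, mul_comm]
    have hA := hasSum_mixed_pow p q m
    have hsm : Summable fun n : ℤ => (2 * (m * I) : ℂ) ^ (p + q + 2) /
        ((m * I + n) ^ (p + 1) * (m * I - n) ^ (q + 1)) := by
      simpa only [mul_one_div, Int.cast_natCast] using
        (hs.prod_factor (m : ℤ)).mul_left ((2 * (m * I) : ℂ) ^ (p + q + 2))
    have hB := hA.unique (hsm.hasSum.mono_left (SummationFilter.symmetricIcc ℤ).le_atTop)
    simp only [← mul_one_div ((2 * (m * I) : ℂ) ^ (p + q + 2)), tsum_mul_left] at hB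
    rw [hc] at hB
    simp only [Int.cast_natCast]
    rw [ofReal_div, hB]
    push_cast
    have hsq : ((-1 : ℂ) ^ h) * (-1) ^ h = 1 := by rw [← pow_add, ← two_mul]; simp
    rw [← mul_div_assoc, eq_div_iff (pow_ne_zero _ (mul_ne_zero two_ne_zero hm))]
    linear_combination (-(2 * m : ℂ) ^ (2 * h) * 
      ∑' x : ℤ, 1 / ((m * I + x : ℂ) ^ (p + 1) * (m * I - x) ^ (q + 1))) * hsq
  have hzero : ∑' n : ℤ, 1 / ((((0 : ℤ) : ℂ) * I + n) ^ (p + 1) *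
      (((0 : ℤ) : ℂ) * I - n) ^ (q + 1)) = (-1) ^ (q + 1) * (2 * riemannZeta (2 * h)) := by
    have := two_mul_riemannZeta_eq_tsum_int_inv_pow_of_even (k := 2 * h) (by omega)
      (even_two_mul h)
    push_cast at this
    rw [this, ← tsum_mul_left]
    refine tsum_congr fun n => ?_
    rw [← hpq, Int.cast_zero, zero_mul, zero_add, zero_sub, neg_pow (n : ℂ),
      show p + q + 2 = (p + 1) + (q + 1) by ring, pow_add (n : ℂ) (p + 1)]
    rcases neg_one_pow_eq_or ℂ (q + 1) with h | h <;> rw [h] <;> simp [mul_comm]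
  have hsum := (hs.prod.comp_injective
    (Nat.cast_injective.comp PNat.coe_injective : Function.Injective fun m : ℕ+ => ((m : ℕ) : ℤ)))
  simp only [Function.comp_def, hin] at hsum
  rw [hzero] at h0
  simp only [hin, tsum_mul_left] at h0
  have hsum' := (summable_mul_left_iff (pow_ne_zero h (by norm_num : (-1 : ℂ) ≠ 0))).mp hsum
  obtain ⟨T, hT⟩ := hsum'
  have hsq : ((-1 : ℂ) ^ h) * (-1) ^ h = 1 := by rw [← pow_add, ← two_mul]; simp
  have hsgn : (-1 : ℂ) ^ (q + 1) * (-1) ^ h = -1 := by rw [← pow_add, hodd.neg_one_pow]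
  rw [two_nsmul, hT.tsum_eq] at h0
  have hz : riemannZeta (2 * h) = T := by
    linear_combination riemannZeta (2 * h) * hsgn + T * hsq - 1 / 2 * (-1) ^ h * h0
  rw [hz]
  exact hT

/-! ### Lambert series and regrouping by divisors. -/

/-- For a, b ≥ 1 one has 2ab ≥ a + b, so the exponential is at most e^(-πa) e^(-πb) and the
variables separate. -/
theorem summable_mul_pow_mul_exp (j : ℕ) : Summable fun x : ℕ+ × ℕ+ =>
    ((x.1 : ℝ) * x.2) ^ j * Real.exp (-2 * Real.pi * x.1 * x.2) := by
  have h1 : Summable fun n : ℕ+ => (n : ℝ) ^ j * Real.exp (-Real.pi * n) :=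
    (Real.summable_pow_mul_exp_neg_nat_mul j Real.pi_pos).comp_injective PNat.coe_injective
  refine Summable.of_nonneg_of_le (fun x => by positivity) (fun x => ?_)
    (h1.mul_of_nonneg h1 (fun n => by positivity) (fun n => by positivity))
  have ha : (1 : ℝ) ≤ x.1 := by exact_mod_cast x.1.pos
  have hb : (1 : ℝ) ≤ x.2 := by exact_mod_cast x.2.pos
  rw [mul_mul_mul_comm, ← mul_pow, ← Real.exp_add]
  gcongr
  nlinarith [Real.pi_pos, mul_nonneg (sub_nonneg.2 ha) (sub_nonneg.2 hb),
    mul_nonneg Real.pi_pos.le (by nlinarith : (0 : ℝ) ≤ 2 * x.1 * x.2 - x.1 - x.2)]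

/-- The polynomial multiplying the exponential in the Lambert series of weights `p + 1`, `q + 1`. -/
noncomputable def lambertPoly (p q : ℕ) (x : ℝ) : ℝ :=
  ∑ i ∈ Finset.range (p + 1), (q + i).choose i * (x ^ (p - i) / ((p - i)! : ℝ)) +
    ∑ i ∈ Finset.range (q + 1), (p + i).choose i * (x ^ (q - i) / ((q - i)! : ℝ))

theorem lambertPoly_nonneg (p q : ℕ) {x : ℝ} (hx : 0 ≤ x) : 0 ≤ lambertPoly p q x := by
  unfold lambertPoly
  positivity

theorem summable_lipschitz_prod (j : ℕ) : Summable fun x : ℕ+ × ℕ+ =>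
    (4 * Real.pi * x.1 * x.2) ^ j / (j ! : ℝ) * Real.exp (-2 * Real.pi * x.1 * x.2) := by
  refine ((summable_mul_pow_mul_exp j).mul_left ((4 * Real.pi) ^ j / (j ! : ℝ))).congr fun x => ?_
  rw [mul_assoc (4 * Real.pi), mul_pow (4 * Real.pi)]
  ring

theorem lambertPoly_mul (p q : ℕ) (x c : ℝ) : lambertPoly p q x * c =
    ∑ i ∈ Finset.range (p + 1), (q + i).choose i * (x ^ (p - i) / ((p - i)! : ℝ) * c) +
    ∑ i ∈ Finset.range (q + 1), (p + i).choose i * (x ^ (q - i) / ((q - i)! : ℝ) * c) := by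
  simp only [lambertPoly, add_mul, Finset.sum_mul, mul_assoc]

theorem summable_lambertPoly_prod (p q : ℕ) : Summable fun x : ℕ+ × ℕ+ =>
    lambertPoly p q (4 * Real.pi * x.1 * x.2) * Real.exp (-2 * Real.pi * x.1 * x.2) := by
  simp only [lambertPoly_mul]
  exact (summable_sum fun i _ => (summable_lipschitz_prod _).mul_left _).add
    (summable_sum fun i _ => (summable_lipschitz_prod _).mul_left _)

/-- Only i = p and i = q meet the constant 1/2, each with the same binomial weight; this constant is
the source of ζ(2h-1). -/
theorem sum_choose_mul_lipschitzSum (p q : ℕ) (m : ℕ+) :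
    ∑ i ∈ Finset.range (p + 1), (q + i).choose i * lipschitzSum (p - i) m +
        ∑ i ∈ Finset.range (q + 1), (p + i).choose i * lipschitzSum (q - i) m =
      ∑' r : ℕ+, lambertPoly p q (4 * Real.pi * m * r) * Real.exp (-2 * Real.pi * m * r) +
        (p + q).choose p := by
  have hs : ∀ j : ℕ, Summable fun r : ℕ+ =>
      (4 * Real.pi * m * r) ^ j / (j ! : ℝ) * Real.exp (-2 * Real.pi * m * r) := fun j =>
    (summable_lipschitz_prod j).prod_factor m
  have hdelta : ∀ p q : ℕ, ∑ i ∈ Finset.range (p + 1),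
      ((q + i).choose i : ℝ) * (if p - i = 0 then 1 / 2 else 0) = (p + q).choose p * (1 / 2) := by
    intro p q
    rw [Finset.sum_eq_single p]
    · simp [add_comm]
    · intro i hi hne
      have := Finset.mem_range.mp hi
      rw [if_neg (by omega), mul_zero]
    · simp
  simp only [lambertPoly_mul, lipschitzSum, mul_add, Finset.sum_add_distrib, hdelta]
  rw [Summable.tsum_add (summable_sum fun i _ => (hs _).mul_left _)
      (summable_sum fun i _ => (hs _).mul_left _),
    Summable.tsum_finsetSum fun i _ => (hs _).mul_left _,
    Summable.tsum_finsetSum fun i _ => (hs _).mul_left _]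
  simp only [tsum_mul_left]
  rw [add_comm q p, Nat.choose_symm_add]
  ring

/-- Regrouping a double series along `m * r = N`. -/
theorem hasSum_divisorPower_mul {s : ℤ} {g : ℕ → ℝ}
    (hg : Summable fun x : ℕ+ × ℕ+ => (x.1 : ℝ) ^ s * g (x.1 * x.2)) :
    HasSum (fun N : ℕ+ => divisorPower s N * g N)
      (∑' m : ℕ+, ∑' r : ℕ+, (m : ℝ) ^ s * g (m * r)) := by
  rw [← hg.tsum_prod]
  have h := (sigmaAntidiagonalEquivProd.hasSum_iff.mpr hg.hasSum).sigma
    (g := fun N : ℕ+ => divisorPower s N * g N) fun N => ?_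
  · exact h
  · have hfin := hasSum_fintype (fun c : (N : ℕ).divisorsAntidiagonal =>
      ((fun x : ℕ+ × ℕ+ => (x.1 : ℝ) ^ s * g (x.1 * x.2)) ∘ sigmaAntidiagonalEquivProd) ⟨N, c⟩)
    suffices hval : divisorPower s N * g N = _ from hval ▸ hfin
    simp only [Function.comp_def, sigmaAntidiagonalEquivProd, divisorsAntidiagonalFactors,
      Equiv.coe_fn_mk, PNat.mk_coe, Finset.univ_eq_attach]
    rw [Finset.sum_attach (N : ℕ).divisorsAntidiagonal
      (fun x : ℕ × ℕ => (x.1 : ℝ) ^ s * g (x.1 * x.2)),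
      Nat.sum_divisorsAntidiagonal (fun a b : ℕ => (a : ℝ) ^ s * g (a * b)), divisorPower,
      Finset.sum_mul]
    refine Finset.sum_congr rfl fun d hd => ?_
    rw [Nat.mul_div_cancel' (Nat.dvd_of_mem_divisors hd)]

/-- The term `Q (4πN) exp (-2πN)` of a Lambert series. -/
noncomputable def lambertTerm (p q N : ℕ) : ℝ :=
  lambertPoly p q (4 * Real.pi * N) * Real.exp (-2 * Real.pi * N)

theorem summable_lambertSeries_prod (p q : ℕ) {s : ℤ} (hs : s ≤ 0) : Summable fun x : ℕ+ × ℕ+ =>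
    (x.1 : ℝ) ^ s * lambertTerm p q (x.1 * x.2) := by
  unfold lambertTerm
  refine Summable.of_nonneg_of_le (fun x => ?_) (fun x => ?_) (summable_lambertPoly_prod p q)
  · have := lambertPoly_nonneg p q (x := 4 * Real.pi * ((x.1 * x.2 : ℕ) : ℝ)) (by positivity)
    positivity
  · have h1 := lambertPoly_nonneg p q (x := 4 * Real.pi * x.1 * x.2) (by positivity)
    push_cast
    simp only [← mul_assoc]
    have ha : (1 : ℝ) ≤ x.1 := by exact_mod_cast x.1.pos
    rw [mul_assoc]
    exact mul_le_of_le_one_left (by positivity) (zpow_le_one_of_nonpos₀ ha hs)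

open Complex in
theorem hasSum_zpow_riemannZeta {h : ℕ} (hh : 2 ≤ h) :
    HasSum (fun m : ℕ+ => (((m : ℝ) ^ (1 - 2 * (h : ℤ)) : ℝ) : ℂ)) (riemannZeta (2 * h - 1)) := by
  have e : (2 * h - 1 : ℂ) = ((2 * h - 1 : ℕ) : ℂ) := by
    rw [Nat.cast_sub (by omega)]
    push_cast
    ring
  have hsum : Summable fun n : ℕ => 1 / (n : ℂ) ^ (2 * h - 1) := by
    have := (Real.summable_one_div_nat_pow (p := 2 * h - 1)).mpr (by omega)
    refine (hasSum_ofReal.mpr this.hasSum).summable.congr fun n => ?_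
    push_cast
    rfl
  have hterm : ∀ m : ℕ+, (((m : ℝ) ^ (1 - 2 * (h : ℤ)) : ℝ) : ℂ) =
      1 / (m : ℂ) ^ (2 * h - 1) := by
    intro m
    rw [show 1 - 2 * (h : ℤ) = -((2 * h - 1 : ℕ) : ℤ) by omega, zpow_neg, zpow_natCast, one_div]
    push_cast
    rfl
  rw [e, zeta_nat_eq_tsum_of_gt_one (by omega), ← tsum_zero_pnat_eq_tsum_nat hsum,
    Nat.cast_zero, zero_pow (by omega), div_zero, zero_add]
  simp only [hterm]
  exact (hsum.comp_injective PNat.coe_injective).hasSum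

theorem hasSum_lambertTerm_riemannZeta {p q h : ℕ} (hpq : p + q + 2 = 2 * h) (hh : 2 ≤ h)
    (hodd : Odd (q + 1 + h)) :
    HasSum (fun m : ℕ+ => ((((m : ℝ) ^ (1 - 2 * (h : ℤ)) *
      (∑' r : ℕ+, lambertTerm p q (m * r) + (p + q).choose p) : ℝ)) : ℂ))
      (riemannZeta (2 * h) * (2 ^ (2 * h) / (4 * Real.pi))) := by
  have hA := (hasSum_lipschitzSum_riemannZeta hpq hh hodd).mul_right
    ((2 : ℂ) ^ (2 * h) / (4 * Real.pi))
  refine hA.congr_fun fun m => ?_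
  have hm : (m : ℝ) ≠ 0 := by exact_mod_cast m.ne_zero
  rw [sum_choose_mul_lipschitzSum]
  have hterm : ∀ r : ℕ+, lambertTerm p q (m * r) =
      lambertPoly p q (4 * Real.pi * m * r) * Real.exp (-2 * Real.pi * m * r) := by
    intro r
    rw [lambertTerm, Nat.cast_mul, ← mul_assoc, ← mul_assoc]
  simp only [hterm]
  generalize (∑' r : ℕ+, lambertPoly p q (4 * Real.pi * m * r) *
    Real.exp (-2 * Real.pi * m * r) + (p + q).choose p) = T
  have hreal : (m : ℝ) ^ (1 - 2 * (h : ℤ)) * T =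
      4 * Real.pi * m * T / (2 * m) ^ (2 * h) * (2 ^ (2 * h) / (4 * Real.pi)) := by
    rw [zpow_sub₀ hm, zpow_one, show 2 * (h : ℤ) = ((2 * h : ℕ) : ℤ) by push_cast; rfl,
      zpow_natCast, mul_pow]
    have := Real.pi_ne_zero
    field_simp
  rw [hreal]
  push_cast
  rfl

open Complex in
theorem riemannZeta_odd_eq_lambertSeries {p q h : ℕ} (hpq : p + q + 2 = 2 * h) (hh : 2 ≤ h)
    (hodd : Odd (q + 1 + h)) :
    Summable (fun N : ℕ+ => divisorPower (1 - 2 * (h : ℤ)) N * lambertTerm p q N) ∧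
    riemannZeta (2 * h) * (2 ^ (2 * h) / (4 * Real.pi)) =
      (p + q).choose p * riemannZeta (2 * h - 1) +
      ((∑' N : ℕ+, divisorPower (1 - 2 * (h : ℤ)) N * lambertTerm p q N : ℝ) : ℂ) := by
  have hD := summable_lambertSeries_prod p q (s := 1 - 2 * (h : ℤ)) (by omega)
  have hN := hasSum_divisorPower_mul hD
  refine ⟨hN.summable, ?_⟩
  rw [hN.tsum_eq]
  refine (hasSum_lambertTerm_riemannZeta hpq hh hodd).unique ?_
  refine (((hasSum_zpow_riemannZeta hh).mul_left ((p + q).choose p : ℂ)).add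
    (hasSum_ofReal.mpr hD.prod.hasSum)).congr_fun fun m => ?_
  simp only [tsum_mul_left]
  push_cast
  ring

/-! ### Matching coefficients and the final formulas. -/

/-- The two binomials in the bracket give the two halves of `lambertPoly`. The second vanishes for i
< 2t, and shifting i by 2t leaves a sum up to q. -/
theorem sum_range_eq_factorial_mul_lambertPoly {p q t : ℕ} (hpq : p = q + 2 * t) (x : ℝ) :
    ∑ i ∈ Finset.range (p + 1), (((2 * t)! : ℝ) * ((q + i)! : ℝ)) / ((i ! : ℝ) * ((p - i)! : ℝ)) *
      ((p.choose (2 * t) : ℝ) + (i.choose (2 * t) : ℝ)) * x ^ (p - i) =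
      (p ! : ℝ) * lambertPoly p q x := by
  have hf : ∀ n : ℕ, (n ! : ℝ) ≠ 0 := fun n => by positivity
  unfold lambertPoly
  simp only [mul_add, add_mul, Finset.sum_add_distrib, Finset.mul_sum]
  congr 1
  · refine Finset.sum_congr rfl fun i _ => ?_
    have h1 : (p.choose (2 * t) : ℝ) * ((2 * t)! : ℝ) * (q ! : ℝ) = p ! := by
      have := Nat.choose_mul_factorial_mul_factorial (show 2 * t ≤ p by omega)
      rw [show p - 2 * t = q by omega] at this
      exact_mod_cast this
    have h2 : ((q + i).choose i : ℝ) * (i ! : ℝ) * (q ! : ℝ) = (q + i)! := by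
      have := Nat.choose_mul_factorial_mul_factorial (show i ≤ q + i by omega)
      rw [show q + i - i = q by omega] at this
      exact_mod_cast this
    rw [← h1, ← h2]
    field_simp
  · rw [show p + 1 = 2 * t + (q + 1) by omega, Finset.sum_range_add, Finset.sum_eq_zero, zero_add]
    · refine Finset.sum_congr rfl fun i hi => ?_
      have hi' := Finset.mem_range.mp hi
      have h1 : ((2 * t + i).choose (2 * t) : ℝ) * ((2 * t)! : ℝ) * (i ! : ℝ) = (2 * t + i)! := by
        have := Nat.choose_mul_factorial_mul_factorial (show 2 * t ≤ 2 * t + i by omega)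
        rw [show 2 * t + i - 2 * t = i by omega] at this
        exact_mod_cast this
      have h2 : ((p + i).choose i : ℝ) * (i ! : ℝ) * (p ! : ℝ) = (p + i)! := by
        have := Nat.choose_mul_factorial_mul_factorial (show i ≤ p + i by omega)
        rw [show p + i - i = p by omega] at this
        exact_mod_cast this
      have h0 : ((2 * t + i).choose (2 * t) : ℝ) ≠ 0 := by
        have := Nat.choose_pos (show 2 * t ≤ 2 * t + i by omega)
        positivity
      rw [show p - (2 * t + i) = q - i by omega, show q + (2 * t + i) = p + i by omega, ← h1, ← h2]
      field_simp
    · intro i hi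
      rw [Nat.choose_eq_zero_of_lt (Finset.mem_range.mp hi)]
      simp

theorem zetaSeriesTerm_eq {h k p q : ℕ} (hk : Even k) (hp : p + 1 = h + k / 2)
    (hq : q + 1 + k / 2 = h) (m : ℕ) :
    zetaSeriesTerm h k m =
      (p ! : ℝ) * (divisorPower (1 - 2 * (h : ℤ)) m * lambertTerm p q m) := by
  obtain ⟨t, rfl⟩ := hk
  have ht : (t + t) / 2 = t := by omega
  rw [ht] at hp hq
  have hpoly := sum_range_eq_factorial_mul_lambertPoly (p := p) (q := q) (t := t) (by omega)
    (4 * Real.pi * m)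
  rw [zetaSeriesTerm, ht, lambertTerm]
  rw [show (p ! : ℝ) * (divisorPower (1 - 2 * (h : ℤ)) m *
      (lambertPoly p q (4 * Real.pi * m) * Real.exp (-2 * Real.pi * m))) =
    divisorPower (1 - 2 * (h : ℤ)) m * Real.exp (-2 * Real.pi * m) *
      ((p ! : ℝ) * lambertPoly p q (4 * Real.pi * m)) by ring, ← hpoly]
  congr 1
  refine Finset.sum_nbij' (fun l => (l + t - 1).toNat) (fun i => (i : ℤ) + 1 - t) ?_ ?_ ?_ ?_ ?_
  · intro l hl
    rw [Finset.mem_Icc] at hl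
    rw [Finset.mem_range]
    omega
  · intro i hi
    rw [Finset.mem_range] at hi
    rw [Finset.mem_Icc]
    omega
  · intro l hl
    rw [Finset.mem_Icc] at hl
    omega
  · intro i _
    omega
  · intro l hl
    rw [Finset.mem_Icc] at hl
    rw [show ((h : ℤ) + l - 2).toNat = q + (l + t - 1).toNat by omega,
      show ((h : ℤ) - l).toNat = p - (l + t - 1).toNat by omega,
      show t + h - 1 = p by omega, show ((t : ℤ) + l - 1) = l + t - 1 by ring,
      show (h : ℤ) - l = ((p - (l + t - 1).toNat : ℕ) : ℤ) by omega, zpow_natCast, two_mul]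

theorem terrasGrosswaldTerm_eq {h : ℕ} (hh : 2 ≤ h) (m : ℕ) :
    terrasGrosswaldTerm h m = zetaSeriesTerm h 2 m := by
  rw [terrasGrosswaldTerm, zetaSeriesTerm]
  congr 1
  refine Finset.sum_nbij' (fun i => (i : ℤ)) Int.toNat ?_ ?_ ?_ ?_ ?_
  · intro i hi
    rw [Finset.mem_range] at hi
    rw [Finset.mem_Icc]
    omega
  · intro l hl
    rw [Finset.mem_Icc] at hl
    rw [Finset.mem_range]
    omega
  · intro i _
    simp
  · intro l hl
    rw [Finset.mem_Icc] at hl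
    omega
  · intro i hi
    rw [Finset.mem_range] at hi
    rw [show ((h : ℤ) + i - 2).toNat = h + i - 2 by omega,
      show ((h : ℤ) - i).toNat = h - i by omega, show 2 / 2 + h - 1 = h by omega,
      show ((i : ℤ) + ((2 / 2 : ℕ) : ℤ) - 1).toNat = i by omega,
      show ((((2 / 2 : ℕ) : ℤ)) + i - 1).toNat = i by omega,
      show (h : ℤ) - i = ((h - i : ℕ) : ℤ) by omega, zpow_natCast, Nat.cast_choose_two,
      Nat.cast_choose_two, Nat.factorial_two]
    push_cast
    ring

/-- The sign is read off from Euler's formula, as ζ(2h) is a sum of nonnegative terms. -/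
theorem abs_bernoulli_two_mul {h : ℕ} (hh : h ≠ 0) :
    |(bernoulli (2 * h) : ℝ)| = (-1) ^ (h + 1) * (bernoulli (2 * h) : ℝ) := by
  have h1 := (hasSum_zeta_nat hh).nonneg fun n => by positivity
  have h2 : 0 ≤ (-1 : ℝ) ^ (h + 1) * (bernoulli (2 * h) : ℝ) := by
    by_contra hneg
    have hpos : (0 : ℝ) < 2 ^ (2 * h - 1) * Real.pi ^ (2 * h) / ((2 * h)! : ℝ) := by positivity
    refine absurd h1 (not_le.mpr (lt_of_eq_of_lt ?_ (mul_neg_of_pos_of_neg hpos (not_le.mp hneg))))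
    ring
  rw [← abs_of_nonneg h2, abs_mul, abs_pow, abs_neg, abs_one, one_pow, one_mul]

open Complex in
theorem riemannZeta_odd_formula {h k : ℕ} (hk : k ≡ 2 [MOD 4]) (hkh : k / 2 < h) :
    Summable (fun m : ℕ+ => zetaSeriesTerm h k m) ∧
      riemannZeta (2 * (h : ℂ) - 1) =
        ((((h - k / 2 - 1)! : ℝ) / ((2 * h - 2)! : ℝ) *
          ((4 * Real.pi) ^ (2 * h - 1) * ((h + k / 2 - 1)! : ℝ) * |(bernoulli (2 * h) : ℝ)| /
              (2 * ((2 * h)! : ℝ))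
            - ∑' m : ℕ+, zetaSeriesTerm h k m) : ℝ) : ℂ) := by
  have hk4 : k % 4 = 2 := hk
  obtain ⟨p, hp⟩ : ∃ p, p + 1 = h + k / 2 := ⟨h + k / 2 - 1, by omega⟩
  obtain ⟨q, hq⟩ : ∃ q, q + 1 + k / 2 = h := ⟨h - k / 2 - 1, by omega⟩
  have hodd : Odd (q + 1 + h) := by
    rw [Nat.odd_iff]
    omega
  obtain ⟨hS, hZ⟩ := riemannZeta_odd_eq_lambertSeries (p := p) (q := q) (h := h) (by omega)
    (by omega) hodd
  have hterm := zetaSeriesTerm_eq (Nat.even_iff.mpr (by omega : k % 2 = 0)) hp hq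
  simp only [hterm, tsum_mul_left]
  refine ⟨hS.mul_left _, ?_⟩
  rw [show h - k / 2 - 1 = q by omega, show h + k / 2 - 1 = p by omega,
    show 2 * h - 2 = p + q by omega, abs_bernoulli_two_mul (by omega)]
  have hch : (((p + q).choose p * p ! * q ! : ℕ) : ℂ) = ((p + q)! : ℕ) := by
    congr 1
    simpa using Nat.choose_mul_factorial_mul_factorial (show p ≤ p + q by omega)
  rw [riemannZeta_two_mul_nat (by omega)] at hZ
  generalize (∑' N : ℕ+, divisorPower (1 - 2 * (h : ℤ)) N * lambertTerm p q N) = S at hZ ⊢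
  generalize riemannZeta (2 * h - 1) = Z at hZ ⊢
  have hf : ∀ n : ℕ, (n ! : ℂ) ≠ 0 := fun n => by exact_mod_cast n.factorial_ne_zero
  have hpi : (Real.pi : ℂ) ≠ 0 := by exact_mod_cast Real.pi_ne_zero
  -- Euler's value of ζ(2h), rescaled: 2^(2h-1) π^(2h) · 2^(2h)/(4π) = (4π)^(2h-1)/2.
  have hB : ((-1) ^ (h + 1) * 2 ^ (2 * h - 1) * (Real.pi : ℂ) ^ (2 * h) * bernoulli (2 * h) /
      ((2 * h)! : ℂ)) * (2 ^ (2 * h) / (4 * Real.pi)) =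
      (4 * Real.pi) ^ (2 * h - 1) * ((-1) ^ (h + 1) * bernoulli (2 * h)) /
        (2 * ((2 * h)! : ℂ)) := by
    obtain ⟨n, hn⟩ : ∃ n, 2 * h = n + 1 := ⟨2 * h - 1, by omega⟩
    rw [hn, Nat.add_sub_cancel, mul_pow, show (4 : ℂ) = 2 * 2 by norm_num, mul_pow, pow_succ,
      pow_succ]
    field_simp
    ring
  rw [hB] at hZ
  push_cast at hch ⊢
  rw [← hch]
  have hc0 : ((p + q).choose p : ℂ) ≠ 0 := by
    exact_mod_cast (Nat.choose_pos (show p ≤ p + q by omega)).ne'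
  have hZ' : Z = ((4 * Real.pi) ^ (2 * h - 1) * ((-1) ^ (h + 1) * bernoulli (2 * h)) /
        (2 * ((2 * h)! : ℂ)) - S) / (p + q).choose p := by
    rw [hZ]
    field_simp
    ring
  rw [hZ']
  have := hf p
  have := hf q
  have := hf (2 * h)
  field_simp

theorem proposition7p2 :
    -- the formula for general `k`
    (∀ h k : ℕ, 0 < h → 0 < k → k ≡ 2 [MOD 4] → k / 2 < h →
      Summable (fun m : ℕ+ => zetaSeriesTerm h k m) ∧
      riemannZeta (2 * (h : ℂ) - 1) =
        ((((h - k / 2 - 1)! : ℝ) / ((2 * h - 2)! : ℝ) *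
          ((4 * Real.pi) ^ (2 * h - 1) * ((h + k / 2 - 1)! : ℝ) * |(bernoulli (2 * h) : ℝ)| /
              (2 * ((2 * h)! : ℝ))
            - ∑' m : ℕ+, zetaSeriesTerm h k m) : ℝ) : ℂ)) ∧
    -- the case `k = 2`, the Terras-Grosswald formula
    (∀ h : ℕ, 2 ≤ h →
      Summable (fun m : ℕ+ => terrasGrosswaldTerm h m) ∧
      riemannZeta (2 * (h : ℂ) - 1) =
        ((((h - 2)! : ℝ) / ((2 * h - 2)! : ℝ) *
          ((4 * Real.pi) ^ (2 * h - 1) * (h ! : ℝ) * |(bernoulli (2 * h) : ℝ)| /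
              (2 * ((2 * h)! : ℝ))
            - ∑' m : ℕ+, terrasGrosswaldTerm h m) : ℝ) : ℂ)) := by
  refine ⟨fun h k _ _ hk hkh => riemannZeta_odd_formula hk hkh, fun h hh => ?_⟩
  simp only [terrasGrosswaldTerm_eq hh]
  have := riemannZeta_odd_formula (h := h) (k := 2) rfl (by omega)
  rwa [show h - 2 / 2 - 1 = h - 2 by omega, show h + 2 / 2 - 1 = h by omega] at this
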